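/- Let $(M,g)$ be a connected smooth Riemannian manifold of dimension $n$ with Levi-Civita connection $\nabla$. Suppose that $\nabla$ is projectively flat: every point of $M$ has an open neighbourhood $U$ and a diffeomorphism $\varphi$ of $U$ onto an open subset of $\mathbb{R}^n$ such that a parametrized curve in $U$, defined on an open interval, is a smooth reparametrization of a geodesic of $\nabla$ if and only if its image under $\varphi$ is a smooth reparametrization of a geodesic of the standard flat connection $\partial/\partial x^a$ on $\mathbb{R}^n$ (here reparametrizations have nowhere vanishing derivative). Then $g$ has constant curvature: there is a constant $K\in\mathbb{R}$ such that the Riemann curvature $R(X,Y)Z=\nabla_X\nabla_YZ-\nabla_Y\nabla_XZ-\nabla_{[X,Y]}Z$ satisfies $$R(X,Y)Z=K\bigl(g(Y,Z)X-g(X,Z)Y\bigr)$$ for all smooth vector fields $X,Y,Z$. -/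

import Mathlib

open Bundle
open scoped Manifold ContDiff

noncomputable section

/-- The affine connections on `M`, i.e. the covariant derivatives on its tangent bundle.
As everywhere in Mathlib, `D Y x (X x)` is the value of `∇_X Y` at `x`. -/
abbrev AffineConnection (E : Type*) [NormedAddCommGroup E] [NormedSpace ℝ E]
    (M : Type*) [TopologicalSpace M] [ChartedSpace E M] [IsManifold 𝓘(ℝ, E) ∞ M] :=
  CovariantDerivative 𝓘(ℝ, E) E (fun x : M ↦ TangentSpace 𝓘(ℝ, E) x)

/-- The standard flat connection `∂/∂xᵃ` on a normed space. -/
def flatConnection (E : Type*) [NormedAddCommGroup E] [NormedSpace ℝ E] : AffineConnection E E where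
  toFun Y x := fderiv ℝ (F := E) Y x
  isCovariantDerivativeOnUniv := by
    have key : ∀ {Y : ∀ x : E, TangentSpace 𝓘(ℝ, E) x} {x : E},
        MDiffAt (T% Y) x → DifferentiableAt ℝ (E := E) (F := E) Y x := by
      intro Y x h
      rw [mdifferentiableAt_section] at h
      exact (mdifferentiableAt_iff_differentiableAt.1 h).congr_of_eventuallyEq
        (.of_forall fun y ↦ by simp; rfl)
    constructor
    · intro Y Y' x hY hY' _
      exact fderiv_add (E := E) (F := E) (key hY) (key hY')
    · intro Y g x hY hg _
      have hd : mvfderiv 𝓘(ℝ, E) g x = fderiv ℝ g x := by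
        rw [mvfderiv, mfderiv_eq_fderiv]; rfl
      rw [hd]
      exact fderiv_smul (E := E) (F := E) hg.differentiableAt (key hY)

variable {E : Type*} [NormedAddCommGroup E] [NormedSpace ℝ E]
  {M : Type*} [TopologicalSpace M] [ChartedSpace E M] [IsManifold 𝓘(ℝ, E) ∞ M]
  {N : Type*} [TopologicalSpace N] [ChartedSpace E N] [IsManifold 𝓘(ℝ, E) ∞ N]

/-- The velocity `γ'(t)` of a curve. -/
def velocity (γ : ℝ → M) (t : ℝ) : TangentSpace 𝓘(ℝ, E) (γ t) :=
  mfderiv 𝓘(ℝ, ℝ) 𝓘(ℝ, E) γ t (1 : ℝ)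

/-- The covariant derivative at time `t` of a vector field `V` along a curve `γ`. In the local frame
`e₁, …, eₙ` of `TM` provided by the trivialization at `γ t` one writes `V = ∑ wⁱ eᵢ`, and then
`∇_{γ'} V = ∑ (dwⁱ/dt) eᵢ + ∑ wⁱ ∇_{γ'} eᵢ`. -/
def covDerivAlong (D : AffineConnection E M) (γ : ℝ → M)
    (V : ∀ t, TangentSpace 𝓘(ℝ, E) (γ t)) (t : ℝ) : TangentSpace 𝓘(ℝ, E) (γ t) :=
  letI e := trivializationAt E (fun x : M ↦ TangentSpace 𝓘(ℝ, E) x) (γ t)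
  letI w : ℝ → E := fun τ ↦ (e ⟨γ τ, V τ⟩).2
  e.symm (γ t) (deriv w t) + D (fun y ↦ e.symm y (w t)) (γ t) (velocity γ t)

/-- `γ` is an (affinely parametrized) geodesic of `D` on the open interval `J`. -/
def IsGeodesicOn (D : AffineConnection E M) (γ : ℝ → M) (J : Set ℝ) : Prop :=
  ContMDiffOn 𝓘(ℝ, ℝ) 𝓘(ℝ, E) ∞ γ J ∧ ∀ t ∈ J, covDerivAlong D γ (velocity γ) t = 0

/-- `γ` is an unparametrized geodesic of `D` on the open interval `J`: it is a smooth
reparametrization `c ∘ s` of a geodesic `c`. -/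
def IsUnparamGeodesicOn (D : AffineConnection E M) (γ : ℝ → M) (J : Set ℝ) : Prop :=
  ∃ (s : ℝ → ℝ) (c : ℝ → M), ContDiffOn ℝ ∞ s J ∧ (∀ t ∈ J, deriv s t ≠ 0) ∧
    IsGeodesicOn D c (s '' J) ∧ ∀ t ∈ J, γ t = c (s t)

/-- The diffeomorphism `φ`, from an open subset of `M` to an open subset of `N`, identifies the
geodesics of `D` with those of `D'`, as unparametrized curves: it is a projective equivalence
between `D` and `D'` on these open subsets. -/
def IsProjectiveEquivalence (D : AffineConnection E M) (D' : AffineConnection E N)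
    (φ : OpenPartialHomeomorph M N) : Prop :=
  ContMDiffOn 𝓘(ℝ, E) 𝓘(ℝ, E) ∞ φ φ.source ∧
  ContMDiffOn 𝓘(ℝ, E) 𝓘(ℝ, E) ∞ φ.symm φ.target ∧
  ∀ (γ : ℝ → M) (J : Set ℝ), IsOpen J → J.OrdConnected → Set.MapsTo γ J φ.source →
    (IsUnparamGeodesicOn D γ J ↔ IsUnparamGeodesicOn D' (φ ∘ γ) J)

/-- `D` is projectively flat: locally it is projectively equivalent to the flat connection on the
vector space `E`. -/
def IsProjectivelyFlat (D : AffineConnection E M) : Prop :=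
  ∀ x : M, ∃ φ : OpenPartialHomeomorph M E,
    x ∈ φ.source ∧ IsProjectiveEquivalence D (flatConnection E) φ

/-- The curvature `R(X, Y) Z = ∇_X ∇_Y Z - ∇_Y ∇_X Z - ∇_{[X, Y]} Z` at `x`. -/
def curvature (D : AffineConnection E M) (X Y Z : ∀ x : M, TangentSpace 𝓘(ℝ, E) x) (x : M) :
    TangentSpace 𝓘(ℝ, E) x :=
  D (fun y ↦ D Z y (Y y)) x (X x) - D (fun y ↦ D Z y (X y)) x (Y x)
    - D Z x (VectorField.mlieBracket 𝓘(ℝ, E) X Y x)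

/-- `D` is the Levi-Civita connection of the Riemannian metric `g`: it is torsion-free and `g` is
parallel, i.e. `d(g(Y, Z)) = g(∇Y, Z) + g(Y, ∇Z)`. -/
def IsLeviCivita [FiniteDimensional ℝ E]
    (g : ContMDiffRiemannianMetric 𝓘(ℝ, E) ∞ E (fun x : M ↦ TangentSpace 𝓘(ℝ, E) x))
    (D : AffineConnection E M) : Prop :=
  D.torsion = 0 ∧
  ∀ (x : M) (Y Z : ∀ x : M, TangentSpace 𝓘(ℝ, E) x), MDiffAt (T% Y) x → MDiffAt (T% Z) x →
    ∀ v : TangentSpace 𝓘(ℝ, E) x,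
      mvfderiv 𝓘(ℝ, E) (fun y ↦ g.inner y (Y y) (Z y)) x v =
        g.inner x (D Y x v) (Z x) + g.inner x (Y x) (D Z x v)

/-- The curvature of `D` is that of constant sectional curvature `K` with respect to `g`:
`R(X, Y) Z = K (g(Y, Z) X - g(X, Z) Y)`. -/
def HasConstantCurvature
    (g : ContMDiffRiemannianMetric 𝓘(ℝ, E) ∞ E (fun x : M ↦ TangentSpace 𝓘(ℝ, E) x))
    (D : AffineConnection E M) (K : ℝ) : Prop :=
  ∀ (x : M) (X Y Z : ∀ x : M, TangentSpace 𝓘(ℝ, E) x),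
    CMDiffAt ∞ (T% X) x → CMDiffAt ∞ (T% Y) x → CMDiffAt ∞ (T% Z) x →
    curvature D X Y Z x = K • (g.inner x (Y x) (Z x) • X x - g.inner x (X x) (Z x) • Y x)

end

/-! ### Linear algebra of symmetric bilinear maps and inner products. -/

section LinearAlgebra

variable {V W : Type*} [AddCommGroup V] [Module ℝ V] [AddCommGroup W] [Module ℝ W]

/-! In a flattening chart the geodesics are straight lines, so `∇_u u` is a multiple of `u` for
every constant field `u` (`IsProjectiveEquivalence.connection_self`). As `∇` is torsion-free,
polarization gives a 1-form `α` with `∇_u v = α(u) v + α(v) u` (`exists_isProjForm`). The curvature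
is then expressed by the tensor `P = ∂α - α ⊗ α` alone (`projNabla_curvature`), and parallelism of
the metric becomes a first-order system for its coefficients `G`. Equality of mixed partials is used
twice. Applied to `G(v, v)`, it gives an algebraic condition that forces `P = -K G` at each point
(`schouten_condition`, `exists_eq_mul_of_schouten`); this is already constant curvature pointwise.
Applied to `α`, now subject to `∂α = α ⊗ α - K G`, it gives `dK(x) G(y, z) = dK(y) G(x, z)`. In
dimension at least two, `z = y ≠ 0` orthogonal to `x` yields `dK = 0` (`eventually_schouten_eq`). So
`K` is locally constant, hence constant on a connected manifold. In dimension at most one both sides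
of the curvature identity vanish. -/

/-- A symmetric bilinear map whose quadratic map sends each vector `v` to a multiple of `T v` is the
symmetrization of `α ⊗ T` for a linear form `α`. -/
theorem exists_eq_smul_add_smul_of_forall_self (B : V →ₗ[ℝ] V →ₗ[ℝ] W) (T : V →ₗ[ℝ] W)
    (hT : Function.Injective T) (hsymm : ∀ v w, B v w = B w v)
    (hB : ∀ v, ∃ c : ℝ, B v v = c • T v) :
    ∃ α : V →ₗ[ℝ] ℝ, ∀ v w, B v w = α v • T w + α w • T v := by
  classical
  have hB' : ∀ v, ∃ c : ℝ, B v v = (2 * c) • T v := fun v ↦ by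
    obtain ⟨c, hc⟩ := hB v
    exact ⟨c / 2, by rw [hc]; ring_nf⟩
  choose l hl using hB'
  -- The coefficient is unique only for `v ≠ 0`; a linear form must take the value 0 at 0.
  set α : V → ℝ := fun v ↦ if v = 0 then 0 else l v with hα
  have hα0 : α 0 = 0 := by simp [hα]
  have hBα : ∀ v, B v v = (2 * α v) • T v := fun v ↦ by
    by_cases hv : v = 0
    · simp [hv]
    · simp [hα, hv, hl]
  have huniq : ∀ v, v ≠ 0 → ∀ c : ℝ, B v v = (2 * c) • T v → α v = c := fun v hv c hc ↦ by
    rw [hBα v] at hc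
    have hTv : T v ≠ 0 := fun h ↦ hv (hT (by simpa using h))
    linarith [smul_left_injective ℝ hTv hc]
  have hsmul : ∀ (c : ℝ) v, α (c • v) = c * α v := fun c v ↦ by
    by_cases h : c • v = 0
    · rcases smul_eq_zero.1 h with h' | h' <;> simp [h', hα0]
    · refine huniq _ h _ ?_
      simp only [map_smul, LinearMap.smul_apply, hBα v]
      module
  have hadd : ∀ v w, α (v + w) = α v + α w := fun v w ↦ by
    by_cases hvw : LinearIndependent ℝ ![v, w]
    -- Adding the identities for `v + w` and `v - w` eliminates `B v w`; the two coefficients in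
    -- `key` then vanish, and their sum is additivity.
    · have hp := hBα (v + w)
      have hm := hBα (v - w)
      simp only [map_add, map_sub, LinearMap.add_apply, LinearMap.sub_apply, hBα v, hBα w,
        hsymm w v] at hp hm
      have key : (α (v + w) + α (v - w) - 2 * α v) • v
          + (α (v + w) - α (v - w) - 2 * α w) • w = 0 := by
        apply hT
        have h2 : (2 : ℝ) • T ((α (v + w) + α (v - w) - 2 * α v) • v
          + (α (v + w) - α (v - w) - 2 * α w) • w) = 0 := by
          simp only [map_add, map_smul]
          linear_combination (norm := module) -hp - hm
        rw [map_zero]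
        exact (smul_eq_zero.1 h2).resolve_left two_ne_zero
      obtain ⟨h1, h2⟩ := LinearIndependent.pair_iff.1 hvw _ _ key
      linarith
    · rw [LinearIndependent.pair_iff] at hvw
      push Not at hvw
      obtain ⟨a, b, hab, h⟩ := hvw
      by_cases ha : a = 0
      · have hb := h ha
        have hw : w = 0 := by simpa [ha, hb] using hab
        simp [hw, hα0]
      · have hv : v = (-(b / a)) • w := by
          have : a • v = -(b • w) := eq_neg_of_add_eq_zero_left hab
          rw [← inv_smul_smul₀ ha v, this, smul_neg, smul_smul, neg_smul]
          congr 2; field_simp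
        have hvw : v + w = (-(b / a) + 1) • w := by rw [add_smul, one_smul, ← hv]
        rw [hvw, hsmul]
        conv_rhs => rw [hv, hsmul]
        ring
  refine ⟨⟨⟨α, hadd⟩, hsmul⟩, fun v w ↦ ?_⟩
  change B v w = α v • T w + α w • T v
  have hp := hBα (v + w)
  simp only [map_add, LinearMap.add_apply, hBα v, hBα w, hsymm w v, hadd] at hp
  have h2 : (2 : ℝ) • (B v w - (α v • T w + α w • T v)) = 0 := by
    linear_combination (norm := module) hp
  exact sub_eq_zero.1 ((smul_eq_zero.1 h2).resolve_left two_ne_zero)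

variable {g S : V →ₗ[ℝ] V →ₗ[ℝ] ℝ}

/-- A bilinear form that vanishes on all pairs of orthogonal vectors is a multiple of the inner
product. -/
theorem exists_eq_mul_of_forall_orthogonal (hg : ∀ v w, g v w = g w v)
    (hpos : ∀ v, v ≠ 0 → 0 < g v v) (hS : ∀ v w, g v w = 0 → S v w = 0) :
    ∃ k : ℝ, ∀ v w, S v w = k * g v w := by
  have hr : ∀ u v, v ≠ 0 → S u v * g v v = g u v * S v v := fun u v hv ↦ by
    have := hpos v hv
    have h := hS (u - (g u v / g v v) • v) v (by simp; field_simp; ring)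
    simp only [map_sub, map_smul, LinearMap.sub_apply, LinearMap.smul_apply, smul_eq_mul] at h
    field_simp at h
    linarith
  have hl : ∀ u v, u ≠ 0 → S u v * g u u = g u v * S u u := fun u v hu ↦ by
    have := hpos u hu
    have h := hS u (v - (g u v / g u u) • u) (by simp; field_simp; ring)
    simp only [map_sub, map_smul, smul_eq_mul] at h
    field_simp at h
    linarith
  -- Both `hr` and `hl` compute `S u v`, by projecting off `v` and off `u`; comparing them equates
  -- the ratios.
  have hq : ∀ u v, g u v ≠ 0 → S u u / g u u = S v v / g v v := fun u v h ↦ by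
    have hu : u ≠ 0 := fun h0 ↦ h (by simp [h0])
    have hv : v ≠ 0 := fun h0 ↦ h (by simp [h0])
    have h1 := hpos u hu
    have h2 := hpos v hv
    have h3 := hr u v hv
    have h4 := hl u v hu
    rw [div_eq_div_iff h1.ne' h2.ne']
    apply mul_left_cancel₀ h
    linear_combination g u u * h3 - g v v * h4
  -- Orthogonal vectors are compared through `u + v`, which is orthogonal to neither.
  have hq' : ∀ u v, u ≠ 0 → v ≠ 0 → S u u / g u u = S v v / g v v := fun u v hu hv ↦ by
    by_cases h : g u v = 0
    · have h' : g v u = 0 := by rw [hg, h]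
      rw [hq u (u + v) (by simpa [h] using (hpos u hu).ne'),
        hq v (u + v) (by simpa [h'] using (hpos v hv).ne')]
    · exact hq u v h
  by_cases h : ∃ e : V, e ≠ 0
  · obtain ⟨e, he⟩ := h
    refine ⟨S e e / g e e, fun v w ↦ ?_⟩
    by_cases hv : v = 0
    · simp [hv]
    · have := (hpos v hv).ne'
      rw [hq' e v he hv, div_mul_eq_mul_div, eq_div_iff this, hl v w hv, mul_comm]
  · push Not at h
    exact ⟨0, fun v w ↦ by simp [h v]⟩

/-- The algebraic part of Beltrami's theorem: an integrability condition on the projective Schouten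
tensor `S` that makes it a multiple of the metric. -/
theorem exists_eq_mul_of_schouten (hg : ∀ v w, g v w = g w v) (hpos : ∀ v, v ≠ 0 → 0 < g v v)
    (hS : ∀ t u v, (S t u - S u t) * g v v + S t v * g u v - S u v * g t v = 0) :
    ∃ k : ℝ, ∀ v w, S v w = k * g v w := by
  refine exists_eq_mul_of_forall_orthogonal hg hpos fun e w h ↦ ?_
  by_cases he : e = 0
  · simp [he]
  by_cases hw : w = 0
  · simp [hw]
  have h' : g w e = 0 := by rw [hg, h]
  -- For orthogonal `e`, `w` these two instances form a nonsingular linear system in `S e w` and `S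
  -- w e`, so symmetry of `S` need not be assumed.
  have h1 := hS e w e
  have h2 := hS e w w
  rw [h, h'] at *
  have h3 : S e w - 2 * S w e = 0 :=
    (mul_eq_zero.1 (by linear_combination h1 :
      (S e w - 2 * S w e) * g e e = 0)).resolve_right (hpos e he).ne'
  have h4 : 2 * S e w - S w e = 0 :=
    (mul_eq_zero.1 (by linear_combination h2 :
      (2 * S e w - S w e) * g w w = 0)).resolve_right (hpos w hw).ne'
  linarith

/-- In dimension at least two, every vector is orthogonal to some nonzero vector. -/
theorem exists_ne_zero_orthogonal (hdim : 2 ≤ Module.finrank ℝ V) (v : V) :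
    ∃ w, w ≠ 0 ∧ g v w = 0 := by
  have : FiniteDimensional ℝ V := .of_finrank_pos (by omega)
  have h := LinearMap.finrank_range_add_finrank_ker (g v)
  have h1 := Submodule.finrank_le (LinearMap.range (g v))
  rw [Module.finrank_self] at h1
  obtain ⟨w, hw⟩ := Submodule.exists_mem_ne_zero_of_ne_bot
    (p := LinearMap.ker (g v)) (fun h0 ↦ by rw [h0, finrank_bot] at h; omega)
  exact ⟨w, hw.2, hw.1⟩

/-- In dimension at most one, the curvature-like tensor of a symmetric form vanishes. -/
theorem smul_sub_smul_eq_zero_of_finrank_le_one [FiniteDimensional ℝ V]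
    (hdim : Module.finrank ℝ V ≤ 1) (x y z : V) : g y z • x - g x z • y = 0 := by
  obtain ⟨e, he⟩ := finrank_le_one_iff.1 hdim
  obtain ⟨a, rfl⟩ := he x
  obtain ⟨b, rfl⟩ := he y
  simp only [map_smul, LinearMap.smul_apply, smul_eq_mul]
  module

end LinearAlgebra

/-! ### Curvature and metrics of `∂ + α ⊗ id + id ⊗ α` on a vector space. -/

section FlatCalculus

open Filter Topology

variable {E : Type*} [NormedAddCommGroup E] [NormedSpace ℝ E]
  {F : Type*} [NormedAddCommGroup F] [NormedSpace ℝ F]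

theorem ContDiffAt.differentiableAt_fderiv {f : E → F} {p : E} (hf : ContDiffAt ℝ 2 f p) :
    DifferentiableAt ℝ (fderiv ℝ f) p :=
  (hf.fderiv_right (m := 1) (by norm_num)).differentiableAt one_ne_zero

theorem ContDiffAt.fderiv_fderiv_apply {f : E → F} {p : E} (hf : ContDiffAt ℝ 2 f p) (t u : E) :
    fderiv ℝ (fun q ↦ fderiv ℝ f q u) p t = fderiv ℝ (fderiv ℝ f) p t u := by
  rw [fderiv_clm_apply hf.differentiableAt_fderiv (differentiableAt_const u)]
  simp

theorem ContDiffAt.fderiv_fderiv_comm {f : E → F} {p : E} (hf : ContDiffAt ℝ 2 f p) (t u : E) :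
    fderiv ℝ (fun q ↦ fderiv ℝ f q u) p t = fderiv ℝ (fun q ↦ fderiv ℝ f q t) p u := by
  rw [hf.fderiv_fderiv_apply, hf.fderiv_fderiv_apply]
  exact (hf.isSymmSndFDerivAt (by simp)) t u

/-- The connection `∂ + α ⊗ id + id ⊗ α` on a vector space, projectively equivalent to the flat
one, applied to `Y` and `Z`: this is `∇_Y Z`. -/
noncomputable def projNabla (α : E → E →L[ℝ] ℝ) (Y Z : E → E) (q : E) : E :=
  fderiv ℝ Z q (Y q) + (α q (Y q) • Z q + α q (Z q) • Y q)

/-- The projective Schouten tensor of the connection `∂ + α ⊗ id + id ⊗ α`, up to sign. -/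
noncomputable def schouten (α : E → E →L[ℝ] ℝ) (p : E) : E →L[ℝ] E →L[ℝ] ℝ :=
  fderiv ℝ α p - (α p).smulRight (α p)

theorem schouten_apply (α : E → E →L[ℝ] ℝ) (p u v : E) :
    schouten α p u v = fderiv ℝ α p u v - α p u * α p v := rfl

theorem differentiableAt_projNabla {α : E → E →L[ℝ] ℝ} {Y Z : E → E} {p : E}
    (hα : DifferentiableAt ℝ α p) (hY : DifferentiableAt ℝ Y p) (hZ : ContDiffAt ℝ 2 Z p) :
    DifferentiableAt ℝ (projNabla α Y Z) p :=
  (hZ.differentiableAt_fderiv.clm_apply hY).add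
    (((hα.clm_apply hY).smul (hZ.differentiableAt two_ne_zero)).add
      ((hα.clm_apply (hZ.differentiableAt two_ne_zero)).smul hY))

theorem fderiv_projNabla {α : E → E →L[ℝ] ℝ} {Y Z : E → E} {p : E}
    (hα : DifferentiableAt ℝ α p) (hY : DifferentiableAt ℝ Y p) (hZ : ContDiffAt ℝ 2 Z p) (x : E) :
    fderiv ℝ (projNabla α Y Z) p x =
      fderiv ℝ (fderiv ℝ Z) p x (Y p) + fderiv ℝ Z p (fderiv ℝ Y p x)
      + (fderiv ℝ α p x (Y p) + α p (fderiv ℝ Y p x)) • Z p + α p (Y p) • fderiv ℝ Z p x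
      + (fderiv ℝ α p x (Z p) + α p (fderiv ℝ Z p x)) • Y p + α p (Z p) • fderiv ℝ Y p x := by
  have hZ1 := hZ.differentiableAt two_ne_zero
  have h := (hZ.differentiableAt_fderiv.hasFDerivAt.clm_apply hY.hasFDerivAt).add
    (((hα.hasFDerivAt.clm_apply hY.hasFDerivAt).smul hZ1.hasFDerivAt).add
      ((hα.hasFDerivAt.clm_apply hZ1.hasFDerivAt).smul hY.hasFDerivAt))
  have h' : HasFDerivAt (projNabla α Y Z) _ p := h
  rw [h'.fderiv]
  simp
  module

/-- The curvature of the connection `∂ + α ⊗ id + id ⊗ α`. -/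
theorem projNabla_curvature {α : E → E →L[ℝ] ℝ} {X Y Z : E → E} {p : E}
    (hα : DifferentiableAt ℝ α p) (hX : DifferentiableAt ℝ X p) (hY : DifferentiableAt ℝ Y p)
    (hZ : ContDiffAt ℝ 2 Z p) :
    projNabla α X (projNabla α Y Z) p - projNabla α Y (projNabla α X Z) p
      - projNabla α (VectorField.lieBracket ℝ X Y) Z p =
    (schouten α p (X p) (Y p) - schouten α p (Y p) (X p)) • Z p
      + schouten α p (X p) (Z p) • Y p - schouten α p (Y p) (Z p) • X p := by
  have hsymm := (hZ.isSymmSndFDerivAt (by simp)) (X p) (Y p)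
  -- Only the outer derivatives are unfolded, so that `fderiv_projNabla` applies to the inner ones.
  conv_lhs =>
    rw [projNabla, projNabla.eq_1 α Y (projNabla α X Z)]
  rw [fderiv_projNabla hα hY hZ, fderiv_projNabla hα hX hZ, hsymm]
  simp only [projNabla, VectorField.lieBracket, schouten_apply, map_sub, map_add, map_smul,
    smul_eq_mul]
  module

/-- A family of inner products on `U` for which `∂ + α ⊗ id + id ⊗ α` is a metric connection. -/
structure IsProjMetric (U : Set E) (α : E → E →L[ℝ] ℝ) (G : E → E →ₗ[ℝ] E →ₗ[ℝ] ℝ) : Prop where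
  isOpen : IsOpen U
  contDiffOn_form : ContDiffOn ℝ ∞ α U
  contDiffOn_metric : ∀ v w, ContDiffOn ℝ ∞ (fun q ↦ G q v w) U
  symm : ∀ p ∈ U, ∀ v w, G p v w = G p w v
  pos : ∀ p ∈ U, ∀ v, v ≠ 0 → 0 < G p v v
  fderiv_eq : ∀ p ∈ U, ∀ u v w, fderiv ℝ (fun q ↦ G q v w) p u =
    2 * α p u * G p v w + α p v * G p u w + α p w * G p u v

namespace IsProjMetric

variable {U : Set E} {α : E → E →L[ℝ] ℝ} {G : E → E →ₗ[ℝ] E →ₗ[ℝ] ℝ}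

theorem differentiableAt_form (h : IsProjMetric U α G) {p : E} (hp : p ∈ U) :
    DifferentiableAt ℝ α p :=
  (h.contDiffOn_form.contDiffAt (h.isOpen.mem_nhds hp)).differentiableAt (by simp)

theorem contDiffAt_metric (h : IsProjMetric U α G) {p : E} (hp : p ∈ U) (v w : E) :
    ContDiffAt ℝ ∞ (fun q ↦ G q v w) p :=
  (h.contDiffOn_metric v w).contDiffAt (h.isOpen.mem_nhds hp)

theorem hasFDerivAt_metric (h : IsProjMetric U α G) {p : E} (hp : p ∈ U) (v w : E) :
    HasFDerivAt (fun q ↦ G q v w) (fderiv ℝ (fun q ↦ G q v w) p) p :=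
  ((h.contDiffAt_metric hp v w).differentiableAt (by simp)).hasFDerivAt

theorem hasFDerivAt_form_apply (h : IsProjMetric U α G) {p : E} (hp : p ∈ U) (v : E) :
    HasFDerivAt (fun q ↦ α q v) ((fderiv ℝ α p).flip v) p := by
  simpa using (h.differentiableAt_form hp).hasFDerivAt.clm_apply (hasFDerivAt_const v p)

/-- The integrability condition of the system `fderiv_eq`: differentiate it once more, substitute it
into itself, and use the symmetry of the second derivative of `G(v, v)` in `t` and `u`. -/
theorem schouten_condition (h : IsProjMetric U α G) {p : E} (hp : p ∈ U) (t u v : E) :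
    (schouten α p t u - schouten α p u t) * G p v v + schouten α p t v * G p u v
      - schouten α p u v * G p t v = 0 := by
  have key : ∀ t u : E, fderiv ℝ (fun q ↦ fderiv ℝ (fun q ↦ G q v v) q u) p t =
      2 * (fderiv ℝ α p t u * G p v v
        + α p u * (2 * α p t * G p v v + α p v * G p t v + α p v * G p t v))
      + 2 * (fderiv ℝ α p t v * G p u v
        + α p v * (2 * α p t * G p u v + α p u * G p t v + α p v * G p t u)) := fun t u ↦ by
    have hev : (fun q ↦ fderiv ℝ (fun q ↦ G q v v) q u) =ᶠ[𝓝 p]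
        fun q ↦ 2 * (α q u * G q v v) + 2 * (α q v * G q u v) := by
      filter_upwards [h.isOpen.mem_nhds hp] with q hq
      rw [h.fderiv_eq q hq]
      ring
    rw [hev.fderiv_eq]
    have hd := (((h.hasFDerivAt_form_apply hp u).mul (h.hasFDerivAt_metric hp v v)).const_mul
      2).add (((h.hasFDerivAt_form_apply hp v).mul (h.hasFDerivAt_metric hp u v)).const_mul 2)
    have hd' : HasFDerivAt (fun q ↦ 2 * (α q u * G q v v) + 2 * (α q v * G q u v)) _ p := hd
    rw [hd'.fderiv]
    simp [h.fderiv_eq p hp]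
    ring
  have hsymm := ((h.contDiffAt_metric hp v v).of_le (m := 2)
    (WithTop.coe_le_coe.2 le_top)).fderiv_fderiv_comm t u
  rw [key, key, h.symm p hp u t] at hsymm
  simp only [schouten_apply]
  linear_combination hsymm / 2

/-- The Schouten tensor is a multiple of the metric at each point. -/
theorem exists_schouten_eq (h : IsProjMetric U α G) {p : E} (hp : p ∈ U) :
    ∃ k : ℝ, ∀ v w, schouten α p v w = -(k * G p v w) := by
  obtain ⟨k, hk⟩ := exists_eq_mul_of_schouten (g := G p)
    (S := (ContinuousLinearMap.coeLM ℝ).comp (schouten α p).toLinearMap)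
    (h.symm p hp) (h.pos p hp) (h.schouten_condition hp)
  exact ⟨-k, fun v w ↦ by simpa using hk v w⟩

/-- In dimension at least two, the sectional curvature is locally constant. -/
theorem eventually_schouten_eq (h : IsProjMetric U α G) (hdim : 2 ≤ Module.finrank ℝ E) {p : E}
    (hp : p ∈ U) : ∃ k : ℝ, ∀ᶠ q in 𝓝 p, ∀ v w, schouten α q v w = -(k * G q v w) := by
  obtain ⟨e, he⟩ : ∃ e : E, e ≠ 0 := by
    have : Nontrivial E := Module.nontrivial_of_finrank_pos (R := ℝ) (by omega)
    exact exists_ne 0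
  -- Evaluating on one fixed vector gives a formula for the pointwise factor that is visibly
  -- differentiable.
  set K : E → ℝ := fun q ↦ -(schouten α q e e / G q e e) with hK
  have hS : ∀ q ∈ U, ∀ v w, schouten α q v w = -(K q * G q v w) := fun q hq v w ↦ by
    obtain ⟨k, hk⟩ := h.exists_schouten_eq hq
    have := (h.pos q hq e he).ne'
    simp only [hK, hk]
    field_simp
  have hKd : ∀ q ∈ U, DifferentiableAt ℝ K q := fun q hq ↦ by
    have h1 : DifferentiableAt ℝ (fderiv ℝ α) q :=
      ((h.contDiffOn_form.contDiffAt (h.isOpen.mem_nhds hq)).of_le (m := 2)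
        (WithTop.coe_le_coe.2 le_top)).differentiableAt_fderiv
    have h2 := h.differentiableAt_form hq
    have h3 : DifferentiableAt ℝ (fun q ↦ fderiv ℝ α q e e - α q e * α q e) q :=
      ((h1.clm_apply (differentiableAt_const e)).clm_apply (differentiableAt_const e)).sub
        ((h2.clm_apply (differentiableAt_const e)).mul (h2.clm_apply (differentiableAt_const e)))
    have h4 : DifferentiableAt ℝ (fun q ↦ G q e e) q := (h.hasFDerivAt_metric hq e e).differentiableAt
    simp only [hK, div_eq_mul_inv]
    exact (h3.mul (h4.fun_inv (h.pos q hq e he).ne')).neg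
  have hK0 : ∀ q ∈ U, fderiv ℝ K q = 0 := fun q hq ↦ by
    -- Second derivatives of `α`, with `∂α = α ⊗ α - K G` substituted. All terms except the one in
    -- `dK` are symmetric in `x` and `y`, whence `hrel`.
    have key : ∀ x y z : E, fderiv ℝ (fun q ↦ fderiv ℝ (fun q ↦ α q z) q x) q y =
        (α q y * α q x - K q * G q y x) * α q z + α q x * (α q y * α q z - K q * G q y z)
        - fderiv ℝ K q y * G q x z
        - K q * (2 * α q y * G q x z + α q x * G q y z + α q z * G q y x) := fun x y z ↦ by
      have hα : ∀ q ∈ U, ∀ x z, fderiv ℝ α q x z = α q x * α q z - K q * G q x z :=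
        fun q hq x z ↦ by
          have := hS q hq x z
          rw [schouten_apply] at this
          linear_combination this
      have hev : (fun q ↦ fderiv ℝ (fun q ↦ α q z) q x) =ᶠ[𝓝 q]
          fun q ↦ α q x * α q z - K q * G q x z := by
        filter_upwards [h.isOpen.mem_nhds hq] with r hr
        rw [(h.hasFDerivAt_form_apply hr z).fderiv]
        exact hα r hr x z
      rw [hev.fderiv_eq]
      have hd : HasFDerivAt (fun q ↦ α q x * α q z - K q * G q x z) _ q :=
        ((h.hasFDerivAt_form_apply hq x).mul (h.hasFDerivAt_form_apply hq z)).sub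
        ((hKd q hq).hasFDerivAt.mul (h.hasFDerivAt_metric hq x z))
      rw [hd.fderiv]
      simp [h.fderiv_eq q hq, hα q hq]
      ring
    have hrel : ∀ x y z : E, fderiv ℝ K q x * G q y z = fderiv ℝ K q y * G q x z :=
      fun x y z ↦ by
        have hz : ContDiffAt ℝ 2 (fun q ↦ α q z) q :=
          ((h.contDiffOn_form.contDiffAt (h.isOpen.mem_nhds hq)).of_le
            (WithTop.coe_le_coe.2 le_top)).clm_apply contDiffAt_const
        have hs := hz.fderiv_fderiv_comm x y
        rw [key, key, h.symm q hq x y] at hs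
        linear_combination -hs
    ext x
    obtain ⟨y, hy0, hy⟩ := exists_ne_zero_orthogonal (g := G q) hdim x
    have := hrel x y y
    rw [hy, mul_zero] at this
    exact (mul_eq_zero.1 this).resolve_right (h.pos q hq y hy0).ne'
  obtain ⟨r, hr, hball⟩ := Metric.isOpen_iff.1 h.isOpen p hp
  refine ⟨K p, ?_⟩
  filter_upwards [Metric.ball_mem_nhds p hr] with q hq v w
  rw [hS q (hball hq)]
  rw [Metric.isOpen_ball.is_const_of_fderiv_eq_zero (convex_ball p r).isPreconnected
    (fun y hy ↦ (hKd y (hball hy)).differentiableWithinAt) (fun y hy ↦ hK0 y (hball hy)) hq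
    (Metric.mem_ball_self hr)]

end IsProjMetric

end FlatCalculus

/-! ### Leibniz rule in a frame, and covariant derivatives along curves. -/

section LeibnizRule

open Filter Topology

variable {E : Type*} [NormedAddCommGroup E] [NormedSpace ℝ E]
  {M : Type*} [TopologicalSpace M] [ChartedSpace E M]

namespace AffineConnection

section Frame

variable [FiniteDimensional ℝ E] {σ : ∀ x : M, E →ₗ[ℝ] TangentSpace 𝓘(ℝ, E) x} {f : M → E} {x : M}

theorem eq_sum_frame (f : M → E) (y : M) : σ y (f y) =
    ∑ i, (Module.finBasis ℝ E).coord i (f y) • σ y (Module.finBasis ℝ E i) := by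
  conv_lhs => rw [← (Module.finBasis ℝ E).sum_repr (f y)]
  simp only [map_sum, map_smul, Module.Basis.coord_apply]

theorem hasMFDerivAt_coord (hf : MDiffAt f x) (i : Fin (Module.finrank ℝ E)) :
    HasMFDerivAt 𝓘(ℝ, E) 𝓘(ℝ, ℝ) (fun y ↦ (Module.finBasis ℝ E).coord i (f y)) x
      (((Module.finBasis ℝ E).coord i).toContinuousLinearMap ∘L mfderiv 𝓘(ℝ, E) 𝓘(ℝ, E) f x) :=
  ((Module.finBasis ℝ E).coord i).toContinuousLinearMap.hasMFDerivAt.comp x hf.hasMFDerivAt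

end Frame

variable [IsManifold 𝓘(ℝ, E) ∞ M] (D : AffineConnection E M)

theorem congr_of_eventuallyEq {Y Z : ∀ x : M, TangentSpace 𝓘(ℝ, E) x} {x : M}
    (hY : MDiffAt (T% Y) x) (h : ∀ᶠ y in 𝓝 x, Y y = Z y) : D Y x = D Z x :=
  D.isCovariantDerivativeOnUniv.congr_of_eventuallyEq hY
    (hY.congr_of_eventuallyEq (h.mono fun y hy ↦ by simp [hy])) univ_mem h

theorem sum_smul {ι : Type*} (s : Finset ι) {c : ι → M → ℝ}
    {Y : ι → ∀ x : M, TangentSpace 𝓘(ℝ, E) x} {x : M}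
    (hc : ∀ i, MDiffAt (c i) x) (hY : ∀ i, MDiffAt (T% (Y i)) x) (v : TangentSpace 𝓘(ℝ, E) x) :
    D (fun y ↦ ∑ i ∈ s, c i y • Y i y) x v =
      ∑ i ∈ s, (c i x • D (Y i) x v + mvfderiv 𝓘(ℝ, E) (c i) x v • Y i x) := by
  classical
  induction s using Finset.induction_on with
  | empty =>
    have h0 : D (fun y ↦ 0) = 0 := D.zero
    simp [h0]
  | insert i s his ih =>
    have hs : MDiffAt (T% (fun y ↦ ∑ j ∈ s, c j y • Y j y)) x :=
      .sum_section fun j _ ↦ (hc j).smul_section (hY j)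
    have hi : MDiffAt (T% (c i • Y i)) x := (hc i).smul_section (hY i)
    have h1 : (fun y ↦ ∑ j ∈ insert i s, c j y • Y j y) =
        c i • Y i + fun y ↦ ∑ j ∈ s, c j y • Y j y := by
      ext y
      simp [Finset.sum_insert his]
    rw [h1, D.isCovariantDerivativeOnUniv.add hi hs, Finset.sum_insert his,
      D.isCovariantDerivativeOnUniv.leibniz (hY i) (hc i), add_apply, ih]
    simp

variable [FiniteDimensional ℝ E] {σ : ∀ x : M, E →ₗ[ℝ] TangentSpace 𝓘(ℝ, E) x} {f : M → E} {x : M}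

/-- The Leibniz rule for a section given by its coordinates `f` in a linear frame `σ`. -/
theorem leibniz_frame (hσ : ∀ u, MDiffAt (T% (fun y ↦ σ y u)) x) (hf : MDiffAt f x)
    (v : TangentSpace 𝓘(ℝ, E) x) :
    D (fun y ↦ σ y (f y)) x v =
      σ x (mvfderiv 𝓘(ℝ, E) f x v) + D (fun y ↦ σ y (f x)) x v := by
  -- A basis of `E` reduces the claim to the scalar Leibniz rule.
  have hexp : ∀ f : M → E, (fun y ↦ σ y (f y)) = fun y ↦
      ∑ i, (Module.finBasis ℝ E).coord i (f y) • σ y (Module.finBasis ℝ E i) :=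
    fun f ↦ funext (eq_sum_frame f)
  have hd : ∀ i, mvfderiv 𝓘(ℝ, E) (fun y ↦ (Module.finBasis ℝ E).coord i (f y)) x v =
      (Module.finBasis ℝ E).coord i (mvfderiv 𝓘(ℝ, E) f x v) := fun i ↦ by
    rw [mvfderiv, (hasMFDerivAt_coord hf i).mfderiv]; rfl
  rw [hexp f, hexp fun _ ↦ f x, D.sum_smul _ (fun i ↦ (hasMFDerivAt_coord hf i).mdifferentiableAt) fun i ↦ hσ _,
    D.sum_smul _ (fun i ↦ mdifferentiableAt_const) fun i ↦ hσ _, Finset.sum_add_distrib,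
    add_comm]
  simp only [hd, mvfderiv_const]
  congr 1
  · conv_rhs => rw [← (Module.finBasis ℝ E).sum_repr (mvfderiv 𝓘(ℝ, E) f x v)]
    simp only [map_sum, map_smul, Module.Basis.coord_apply]
  · simp

/-- The covariant derivative along `γ` of the restriction of a vector field `Y` is `∇_{γ'} Y`. -/
theorem covDerivAlong_eq {γ : ℝ → M} {V : ∀ t, TangentSpace 𝓘(ℝ, E) (γ t)} {t : ℝ}
    {Y : ∀ x : M, TangentSpace 𝓘(ℝ, E) x} (hγ : MDiffAt γ t) (hY : MDiffAt (T% Y) (γ t))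
    (hV : ∀ᶠ s in 𝓝 t, V s = Y (γ s)) :
    covDerivAlong D γ V t = D Y (γ t) (velocity γ t) := by
  set e := trivializationAt E (fun x : M ↦ TangentSpace 𝓘(ℝ, E) x) (γ t) with he
  set f : M → E := fun y ↦ (e ⟨y, Y y⟩).2 with hf
  have hmem : γ t ∈ e.baseSet := FiberBundle.mem_baseSet_trivializationAt' (γ t)
  have hbase : ∀ᶠ y in 𝓝 (γ t), y ∈ e.baseSet := e.open_baseSet.mem_nhds hmem
  have hfd : MDiffAt f (γ t) := (mdifferentiableAt_section _ _).1 hY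
  have hσ : ∀ u, MDiffAt (T% (fun y ↦ e.symmₗ ℝ y u)) (γ t) := fun u ↦ by
    rw [e.mdifferentiableAt_section_iff _ _ hmem]
    refine (mdifferentiableAt_const (c := u)).congr_of_eventuallyEq ?_
    filter_upwards [hbase] with y hy
    simp [e.symmₗ_apply hy, e.apply_mk_symm hy]
  have hYe : ∀ᶠ y in 𝓝 (γ t), Y y = e.symmₗ ℝ y (f y) := by
    filter_upwards [hbase] with y hy
    rw [e.symmₗ_apply hy, e.symm_apply_apply_mk hy]
  have hw : (fun s ↦ (e ⟨γ s, V s⟩).2) =ᶠ[𝓝 t] f ∘ γ := by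
    filter_upwards [hV] with s hs
    simp [f, hs]
  -- Chain rule: the coordinates of `V` are those of `Y` composed with `γ`.
  have hderiv : deriv (fun s ↦ (e ⟨γ s, V s⟩).2) t = mvfderiv 𝓘(ℝ, E) f (γ t) (velocity γ t) := by
    have h := mfderiv_comp_apply (I := 𝓘(ℝ, ℝ)) t hfd hγ (1 : ℝ)
    rw [hw.deriv_eq, ← fderiv_apply_one_eq_deriv, ← mfderiv_eq_fderiv]
    exact h
  rw [D.congr_of_eventuallyEq hY hYe, D.leibniz_frame hσ hfd, ← hderiv]
  have hwt : (e ⟨γ t, V t⟩).2 = f (γ t) := hw.eq_of_nhds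
  rw [e.symmₗ_apply hmem, ← hwt, D.congr_of_eventuallyEq (hσ _)
    (hbase.mono fun y hy ↦ e.symmₗ_apply hy _)]
  rfl

end AffineConnection

end LeibnizRule

/-! ### Vector fields in a smooth chart. -/

section ChartFields

open Filter Topology VectorField

variable {E : Type*} [NormedAddCommGroup E] [NormedSpace ℝ E]
  {M : Type*} [TopologicalSpace M] [ChartedSpace E M]

/-- A smooth diffeomorphism from an open subset of `M` to an open subset of `E`. -/
structure IsSmoothChart (φ : OpenPartialHomeomorph M E) : Prop where
  contMDiffOn : ContMDiffOn 𝓘(ℝ, E) 𝓘(ℝ, E) ∞ φ φ.source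
  contMDiffOn_symm : ContMDiffOn 𝓘(ℝ, E) 𝓘(ℝ, E) ∞ φ.symm φ.target

/-- The coordinates of tangent vectors in a chart. -/
noncomputable def chartCoframe (φ : OpenPartialHomeomorph M E) (x : M) :
    TangentSpace 𝓘(ℝ, E) x →L[ℝ] E :=
  mfderiv 𝓘(ℝ, E) 𝓘(ℝ, E) φ x

/-- The tangent vectors with given coordinates in a chart. -/
noncomputable def chartFrame (φ : OpenPartialHomeomorph M E) (x : M) :
    E →L[ℝ] TangentSpace 𝓘(ℝ, E) x :=
  (mfderiv 𝓘(ℝ, E) 𝓘(ℝ, E) φ x).inverse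

/-- The vector field on `M` with given coordinates in a chart. -/
noncomputable def chartField (φ : OpenPartialHomeomorph M E) (z : E → E) (x : M) :
    TangentSpace 𝓘(ℝ, E) x :=
  chartFrame φ x (z (φ x))

/-- The coordinates of a vector field in a chart. -/
noncomputable def chartRep (φ : OpenPartialHomeomorph M E) (Z : ∀ x : M, TangentSpace 𝓘(ℝ, E) x)
    (p : E) : E :=
  chartCoframe φ (φ.symm p) (Z (φ.symm p))

theorem mdifferentiableAt_vectorSpace {z : ∀ p : E, TangentSpace 𝓘(ℝ, E) p} {p : E}
    (hz : DifferentiableAt ℝ (E := E) (F := E) z p) : MDiffAt (T% z) p := by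
  rw [mdifferentiableAt_section]
  exact (mdifferentiableAt_iff_differentiableAt.2 hz).congr_of_eventuallyEq
    (.of_forall fun y ↦ by simp; rfl)

theorem mlieBracket_vectorSpace (y z : ∀ p : E, TangentSpace 𝓘(ℝ, E) p) :
    mlieBracket 𝓘(ℝ, E) y z = lieBracket ℝ y z := by
  rw [← mlieBracketWithin_univ, mlieBracketWithin_eq_lieBracketWithin]
  exact lieBracketWithin_univ

namespace IsSmoothChart

variable {φ : OpenPartialHomeomorph M E} {x : M}

theorem contMDiffAt (h : IsSmoothChart φ) (hx : x ∈ φ.source) : CMDiffAt ∞ φ x :=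
  (h.contMDiffOn x hx).contMDiffAt (φ.open_source.mem_nhds hx)

theorem contMDiffAt_symm (h : IsSmoothChart φ) {p : E} (hp : p ∈ φ.target) :
    CMDiffAt ∞ φ.symm p :=
  (h.contMDiffOn_symm p hp).contMDiffAt (φ.open_target.mem_nhds hp)

theorem mdifferentiable (h : IsSmoothChart φ) : φ.MDifferentiable 𝓘(ℝ, E) 𝓘(ℝ, E) :=
  ⟨h.contMDiffOn.mdifferentiableOn (by simp), h.contMDiffOn_symm.mdifferentiableOn (by simp)⟩

theorem mdifferentiableAt (h : IsSmoothChart φ) (hx : x ∈ φ.source) : MDiffAt φ x :=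
  h.mdifferentiable.mdifferentiableAt hx

theorem isInvertible_mfderiv (h : IsSmoothChart φ) (hx : x ∈ φ.source) :
    (mfderiv 𝓘(ℝ, E) 𝓘(ℝ, E) φ x).IsInvertible :=
  ⟨h.mdifferentiable.mfderiv hx, rfl⟩

theorem isInvertible_mfderiv_symm (h : IsSmoothChart φ) (hx : x ∈ φ.source) :
    (mfderiv 𝓘(ℝ, E) 𝓘(ℝ, E) φ.symm (φ x)).IsInvertible :=
  ⟨h.mdifferentiable.symm.mfderiv (φ.map_source hx), rfl⟩

theorem chartCoframe_chartFrame (h : IsSmoothChart φ) (hx : x ∈ φ.source) (u : E) :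
    chartCoframe φ x (chartFrame φ x u) = u :=
  (h.isInvertible_mfderiv hx).self_apply_inverse u

theorem chartFrame_chartCoframe (h : IsSmoothChart φ) (hx : x ∈ φ.source)
    (v : TangentSpace 𝓘(ℝ, E) x) : chartFrame φ x (chartCoframe φ x v) = v :=
  (h.isInvertible_mfderiv hx).inverse_apply_self v

theorem chartFrame_injective (h : IsSmoothChart φ) (hx : x ∈ φ.source) :
    Function.Injective (chartFrame φ x) :=
  Function.LeftInverse.injective (h.chartCoframe_chartFrame hx)

theorem chartField_chartRep (h : IsSmoothChart φ) (hx : x ∈ φ.source)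
    (Z : ∀ x : M, TangentSpace 𝓘(ℝ, E) x) : chartField φ (chartRep φ Z) x = Z x := by
  rw [chartField, chartRep, φ.left_inv hx, h.chartFrame_chartCoframe hx]

theorem chartFrame_eq_mfderiv_symm (h : IsSmoothChart φ) (hx : x ∈ φ.source) (u : E) :
    chartFrame φ x u = mfderiv 𝓘(ℝ, E) 𝓘(ℝ, E) φ.symm (φ x) u := by
  have h1 : mfderiv 𝓘(ℝ, E) 𝓘(ℝ, E) φ.symm (φ x) (chartCoframe φ x (chartFrame φ x u)) =
    chartFrame φ x u := congr($(h.mdifferentiable.symm_comp_deriv hx) (chartFrame φ x u))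
  rw [← h1, h.chartCoframe_chartFrame hx]

variable [CompleteSpace E] [IsManifold 𝓘(ℝ, E) ∞ M]

/-- `chartField φ z` is by definition the pullback of the vector field `z` along `φ`. -/
theorem contMDiffAt_chartField (h : IsSmoothChart φ) (hx : x ∈ φ.source) {z : E → E}
    (hz : ContDiffAt ℝ ∞ z (φ x)) : CMDiffAt ∞ (T% (chartField φ z)) x :=
  ContMDiffAt.mpullback_vectorField_preimage (contMDiffAt_vectorSpace_iff_contDiffAt.2 hz)
    (h.contMDiffAt hx) (h.isInvertible_mfderiv hx) (by simp)

theorem mdifferentiableAt_chartField (h : IsSmoothChart φ) (hx : x ∈ φ.source) {z : E → E}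
    (hz : DifferentiableAt ℝ z (φ x)) : MDiffAt (T% (chartField φ z)) x :=
  MDifferentiableAt.mpullback_vectorField (mdifferentiableAt_vectorSpace hz)
    (h.contMDiffAt hx) (h.isInvertible_mfderiv hx) (WithTop.coe_le_coe.2 le_top)

/-- On the target, `chartRep φ Z` coincides with the pullback of `Z` along `φ.symm`. -/
theorem contDiffAt_chartRep (h : IsSmoothChart φ) (hx : x ∈ φ.source)
    {Z : ∀ x : M, TangentSpace 𝓘(ℝ, E) x}
    (hZ : CMDiffAt ∞ (T% Z) x) : ContDiffAt ℝ ∞ (chartRep φ Z) (φ x) := by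
  have h1 : CMDiffAt ∞ (T% (mpullback 𝓘(ℝ, E) 𝓘(ℝ, E) φ.symm Z)) (φ x) :=
    ContMDiffAt.mpullback_vectorField_preimage (by rwa [φ.left_inv hx])
      (h.contMDiffAt_symm (φ.map_source hx)) (h.isInvertible_mfderiv_symm hx) (by simp)
  refine (contMDiffAt_vectorSpace_iff_contDiffAt.1 h1).congr_of_eventuallyEq ?_
  filter_upwards [φ.open_target.mem_nhds (φ.map_source hx)] with p hp
  have hp' := φ.map_target hp
  have hinv := h.isInvertible_mfderiv_symm hp'
  have hfr := h.chartFrame_eq_mfderiv_symm hp' (chartRep φ Z p)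
  rw [φ.right_inv hp] at hinv hfr
  symm
  rw [mpullback_apply]
  refine hinv.inverse_apply_eq.2 ?_
  rw [← hfr, chartRep, h.chartFrame_chartCoframe hp']

theorem mlieBracket_chartField (h : IsSmoothChart φ) (hx : x ∈ φ.source) {y z : E → E}
    (hy : DifferentiableAt ℝ y (φ x)) (hz : DifferentiableAt ℝ z (φ x)) :
    mlieBracket 𝓘(ℝ, E) (chartField φ y) (chartField φ z) x =
      chartField φ (lieBracket ℝ y z) x := by
  have : IsManifold 𝓘(ℝ, E) (minSmoothness ℝ 2) M := by
    rw [minSmoothness_of_isRCLikeNormedField]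
    infer_instance
  refine (mpullback_mlieBracket (mdifferentiableAt_vectorSpace hy)
    (mdifferentiableAt_vectorSpace hz) (h.contMDiffAt hx)
    (by rw [minSmoothness_of_isRCLikeNormedField]; exact WithTop.coe_le_coe.2 le_top)).symm.trans ?_
  exact congrArg (chartFrame φ x) (congrFun (mlieBracket_vectorSpace y z) (φ x))

end IsSmoothChart

end ChartFields

/-! ### The connection and its curvature in a chart. -/

section ChartConnection

open Filter Topology VectorField

variable {E : Type*} [NormedAddCommGroup E] [NormedSpace ℝ E] [FiniteDimensional ℝ E]
  {M : Type*} [TopologicalSpace M] [ChartedSpace E M] [IsManifold 𝓘(ℝ, E) ∞ M]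
  {φ : OpenPartialHomeomorph M E} {D : AffineConnection E M} {x : M}

/-- Reduces the connection to its values on fields with constant coordinates, by the Leibniz rule in
the chart frame. -/
theorem IsSmoothChart.connection_chartField (h : IsSmoothChart φ) (hx : x ∈ φ.source) {z : E → E}
    (hz : DifferentiableAt ℝ z (φ x)) (u : E) :
    D (chartField φ z) x (chartFrame φ x u) = chartFrame φ x (fderiv ℝ z (φ x) u)
      + D (chartField φ fun _ ↦ z (φ x)) x (chartFrame φ x u) := by
  have hf : HasMFDerivAt 𝓘(ℝ, E) 𝓘(ℝ, E) (z ∘ φ) x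
      ((fderiv ℝ z (φ x)).comp (chartCoframe φ x)) :=
    hz.hasFDerivAt.hasMFDerivAt.comp x (h.mdifferentiableAt hx).hasMFDerivAt
  have hd : mvfderiv 𝓘(ℝ, E) (z ∘ φ) x (chartFrame φ x u) = fderiv ℝ z (φ x) u := by
    rw [mvfderiv, hf.mfderiv]
    exact congrArg (fderiv ℝ z (φ x)) (h.chartCoframe_chartFrame hx u)
  have key := D.leibniz_frame (σ := fun y ↦ (chartFrame φ y).toLinearMap) (f := z ∘ φ) (x := x)
    (fun u ↦ h.mdifferentiableAt_chartField hx (differentiableAt_const u))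
    hf.mdifferentiableAt (chartFrame φ x u)
  rw [hd] at key
  exact key

/-- In the chart `φ`, the connection `D` is `∂ + α ⊗ id + id ⊗ α`. -/
def IsProjForm (φ : OpenPartialHomeomorph M E) (D : AffineConnection E M)
    (α : E → E →L[ℝ] ℝ) : Prop :=
  ∀ x ∈ φ.source, ∀ u v : E, D (chartField φ fun _ ↦ v) x (chartFrame φ x u) =
    chartFrame φ x (α (φ x) u • v + α (φ x) v • u)

namespace IsProjForm

variable {α : E → E →L[ℝ] ℝ}

theorem connection_eq (hα : IsProjForm φ D α) (h : IsSmoothChart φ) (hx : x ∈ φ.source)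
    {y z : E → E} {Z : ∀ x : M, TangentSpace 𝓘(ℝ, E) x} (hz : DifferentiableAt ℝ z (φ x))
    (hZ : ∀ᶠ y in 𝓝 x, Z y = chartField φ z y) :
    D Z x (chartField φ y x) = chartField φ (projNabla α y z) x := by
  rw [← D.congr_of_eventuallyEq (h.mdifferentiableAt_chartField hx hz)
    (hZ.mono fun y hy ↦ hy.symm), chartField, h.connection_chartField hx hz, hα x hx,
    ← map_add]
  rfl

theorem eventually_connection_eq (hα : IsProjForm φ D α) (h : IsSmoothChart φ)
    (hx : x ∈ φ.source) {Y Z : ∀ x : M, TangentSpace 𝓘(ℝ, E) x} (hZ : CMDiffAt ∞ (T% Z) x) :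
    ∀ᶠ y in 𝓝 x, D Z y (Y y) = chartField φ (projNabla α (chartRep φ Y) (chartRep φ Z)) y := by
  -- `ContDiffAt` of finite order, unlike order `∞`, at a point passes to a neighbourhood.
  have hz : ∀ᶠ p in 𝓝 (φ x), ContDiffAt ℝ 1 (chartRep φ Z) p :=
    ((h.contDiffAt_chartRep hx hZ).of_le (WithTop.coe_le_coe.2 le_top)).eventually (by simp)
  filter_upwards [(φ.continuousAt hx).eventually hz, φ.open_source.mem_nhds hx] with y hy hys
  rw [← hα.connection_eq h hys (hy.differentiableAt one_ne_zero) (Z := Z),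
    h.chartField_chartRep hys]
  filter_upwards [φ.open_source.mem_nhds hys] with y' hy'
  exact (h.chartField_chartRep hy' Z).symm

/-- The curvature in the chart `φ`. -/
theorem curvature_eq (hα : IsProjForm φ D α) (h : IsSmoothChart φ) (hx : x ∈ φ.source)
    (hαd : DifferentiableAt ℝ α (φ x)) {X Y Z : ∀ x : M, TangentSpace 𝓘(ℝ, E) x}
    (hX : CMDiffAt ∞ (T% X) x) (hY : CMDiffAt ∞ (T% Y) x) (hZ : CMDiffAt ∞ (T% Z) x) :
    curvature D X Y Z x = chartField φ
      (fun p ↦ (schouten α p (chartRep φ X p) (chartRep φ Y p)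
          - schouten α p (chartRep φ Y p) (chartRep φ X p)) • chartRep φ Z p
        + schouten α p (chartRep φ X p) (chartRep φ Z p) • chartRep φ Y p
        - schouten α p (chartRep φ Y p) (chartRep φ Z p) • chartRep φ X p) x := by
  have hX' := (h.contDiffAt_chartRep hx hX).differentiableAt (by simp)
  have hY' := (h.contDiffAt_chartRep hx hY).differentiableAt (by simp)
  have hZ' := (h.contDiffAt_chartRep hx hZ).of_le (m := 2) (WithTop.coe_le_coe.2 le_top)
  have hrep : ∀ W : ∀ x : M, TangentSpace 𝓘(ℝ, E) x,
      ∀ᶠ y in 𝓝 x, W y = chartField φ (chartRep φ W) y := fun W ↦ by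
    filter_upwards [φ.open_source.mem_nhds hx] with y hy
    exact (h.chartField_chartRep hy W).symm
  have hbr : mlieBracket 𝓘(ℝ, E) X Y x =
      chartField φ (lieBracket ℝ (chartRep φ X) (chartRep φ Y)) x := by
    rw [← h.mlieBracket_chartField hx hX' hY']
    exact EventuallyEq.mlieBracket_vectorField_eq (hrep X) (hrep Y)
  rw [curvature, hbr, hα.connection_eq h hx (hZ'.differentiableAt two_ne_zero) (hrep Z),
    (hrep X).self_of_nhds, (hrep Y).self_of_nhds,
    hα.connection_eq h hx (differentiableAt_projNabla hαd hY' hZ')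
      (hα.eventually_connection_eq h hx hZ),
    hα.connection_eq h hx (differentiableAt_projNabla hαd hX' hZ')
      (hα.eventually_connection_eq h hx hZ)]
  simp only [chartField, ← map_sub]
  rw [projNabla_curvature hαd hX' hY' hZ']

end IsProjForm

end ChartConnection

/-! ### Straight geodesics make constant fields pregeodesic. -/

section Geodesics

open Filter Topology

variable {E : Type*} [NormedAddCommGroup E] [NormedSpace ℝ E]

theorem hasDerivAt_line (p u : E) (t : ℝ) : HasDerivAt (fun t : ℝ ↦ p + t • u) u t := by
  simpa using ((hasDerivAt_id t).smul_const u).const_add p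

variable {M : Type*} [TopologicalSpace M] [ChartedSpace E M] [IsManifold 𝓘(ℝ, E) ∞ M]
  {φ : OpenPartialHomeomorph M E} {D : AffineConnection E M} {x : M}

theorem IsProjectiveEquivalence.isSmoothChart
    (hD : IsProjectiveEquivalence D (flatConnection E) φ) : IsSmoothChart φ :=
  ⟨hD.1, hD.2.1⟩

variable [FiniteDimensional ℝ E]

/-- Affine lines are geodesics of the flat connection. -/
theorem isGeodesicOn_line (p u : E) (J : Set ℝ) :
    IsGeodesicOn (flatConnection E) (fun t : ℝ ↦ p + t • u) J := by
  have hvel : ∀ t, velocity (fun t : ℝ ↦ p + t • u) t = u := fun t ↦ by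
    rw [velocity, (hasDerivAt_line p u t).hasFDerivAt.hasMFDerivAt.mfderiv]
    exact one_smul ℝ u
  refine ⟨?_, fun t _ ↦ ?_⟩
  · have h : ContDiff ℝ ∞ fun t : ℝ ↦ p + t • u := by fun_prop
    exact h.contMDiff.contMDiffOn
  · rw [AffineConnection.covDerivAlong_eq (Y := fun _ ↦ u) (flatConnection E)
      (hasDerivAt_line p u t).differentiableAt.mdifferentiableAt
      (mdifferentiableAt_vectorSpace (differentiableAt_const u)) (.of_forall hvel)]
    have h0 : fderiv ℝ (fun _ : E ↦ u) (p + t • u) = 0 := fderiv_const_apply u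
    exact congr($h0 (velocity (fun t : ℝ ↦ p + t • u) t))

theorem IsSmoothChart.connection_const_smul (h : IsSmoothChart φ) (hx : x ∈ φ.source) (k : ℝ)
    (u : E) : D (chartField φ fun _ ↦ k • u) x = k • D (chartField φ fun _ ↦ u) x := by
  rw [← D.isCovariantDerivativeOnUniv.smul_const k
    (h.mdifferentiableAt_chartField hx (differentiableAt_const u))]
  congr 1
  ext y
  simp [chartField]

/-- If the curve `c` has velocity `k • u` in the chart `φ` for a function `k`, and is a geodesic,
then the coordinate field `u` is pregeodesic. -/
theorem IsSmoothChart.connection_self_of_connection_smul (h : IsSmoothChart φ)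
    (hx : x ∈ φ.source) {k : E → ℝ} {u : E} (hk : DifferentiableAt ℝ k (φ x)) (hk0 : k (φ x) ≠ 0)
    (h0 : D (chartField φ fun q ↦ k q • u) x (chartFrame φ x (k (φ x) • u)) = 0) :
    ∃ a : ℝ, D (chartField φ fun _ ↦ u) x (chartFrame φ x u) = a • chartFrame φ x u := by
  have hz : HasFDerivAt (fun q ↦ k q • u) ((fderiv ℝ k (φ x)).smulRight u) (φ x) :=
    hk.hasFDerivAt.smul_const u
  rw [h.connection_chartField hx hz.differentiableAt, hz.fderiv,
    h.connection_const_smul hx] at h0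
  simp only [ContinuousLinearMap.smulRight_apply, map_smul, smul_apply] at h0
  -- Solves `0 = ∇_{ku}(ku) = k (∂_u k) u + k² ∇_u u` for `∇_u u`.
  refine ⟨-((k (φ x))⁻¹ * fderiv ℝ k (φ x) u * k (φ x) * (k (φ x))⁻¹), ?_⟩
  have h1 := congrArg (fun w ↦ ((k (φ x))⁻¹ * (k (φ x))⁻¹) • w) h0
  simp only [smul_add, smul_smul, smul_zero] at h1
  have h2 : (k (φ x))⁻¹ * (k (φ x))⁻¹ * (k (φ x) * k (φ x)) = 1 := by field_simp
  simp only [h2, one_smul] at h1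
  rw [eq_neg_of_add_eq_zero_right h1, neg_smul]
  congr 2
  ring

/-- If the geodesics of `D` are straight lines in the chart `φ`, then constant fields are
pregeodesic. -/
theorem IsProjectiveEquivalence.connection_self
    (hD : IsProjectiveEquivalence D (flatConnection E) φ) (hx : x ∈ φ.source) (u : E) :
    ∃ a : ℝ, D (chartField φ fun _ ↦ u) x (chartFrame φ x u) = a • chartFrame φ x u := by
  by_cases hu : u = 0
  · exact ⟨0, by simp [hu]⟩
  have h := hD.isSmoothChart
  set ℓ : ℝ → E := fun t ↦ φ x + t • u with hℓ
  have hℓ0 : ℓ 0 = φ x := by simp [hℓ]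
  have hℓc : Continuous ℓ := by fun_prop
  obtain ⟨r, hr, hball⟩ : ∃ r > 0, Metric.ball (0 : ℝ) r ⊆ ℓ ⁻¹' φ.target :=
    Metric.isOpen_iff.1 (φ.open_target.preimage hℓc) 0
      (by simpa [hℓ0] using φ.map_source hx)
  set J := Metric.ball (0 : ℝ) r with hJ
  have hJn : ∀ t ∈ J, J ∈ 𝓝 t := fun t ht ↦ Metric.isOpen_ball.mem_nhds ht
  have h0J : (0 : ℝ) ∈ J := Metric.mem_ball_self hr
  have hφγ : ∀ t ∈ J, φ (φ.symm (ℓ t)) = ℓ t := fun t ht ↦ φ.right_inv (hball ht)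
  -- Only this direction of the equivalence is needed: lines come from reparametrized geodesics `c ∘
  -- s` of `D`.
  obtain ⟨s, c, hs, hs0, hc, hγc⟩ := (hD.2.2 (fun t ↦ φ.symm (ℓ t)) J Metric.isOpen_ball
    (convex_ball 0 r).ordConnected fun t ht ↦ φ.map_target (hball ht)).2
    ⟨id, ℓ, contDiffOn_id, by simp, isGeodesicOn_line _ _ _, hφγ⟩
  have hsd : ∀ t ∈ J, ContDiffAt ℝ ∞ s t := fun t ht ↦ hs.contDiffAt (hJn t ht)
  -- As `s' ≠ 0`, statements about `c` near `s t` can be checked along `s` near `t`.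
  have hmap : ∀ t ∈ J, map s (𝓝 t) = 𝓝 (s t) := fun t ht ↦
    ((hsd t ht).hasStrictDerivAt (by simp)).map_nhds_eq (hs0 t ht)
  have hcd : ∀ t ∈ J, MDiffAt c (s t) := fun t ht ↦
    ((hc.1 _ ⟨t, ht, rfl⟩).contMDiffAt
      (by rw [← hmap t ht]; exact image_mem_map (hJn t ht))).mdifferentiableAt (by simp)
  have hcs : ∀ t ∈ J, c (s t) ∈ φ.source := fun t ht ↦ hγc t ht ▸ φ.map_target (hball ht)
  have hφc : ∀ t ∈ J, φ (c (s t)) = ℓ t := fun t ht ↦ by rw [← hγc t ht, hφγ t ht]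
  have hvel : ∀ t ∈ J, velocity c (s t) = chartFrame φ (c (s t)) ((deriv s t)⁻¹ • u) :=
    fun t ht ↦ by
    have h1 : HasMFDerivAt 𝓘(ℝ, ℝ) 𝓘(ℝ, E) (φ ∘ c) (s t)
        ((chartCoframe φ (c (s t))).comp (mfderiv 𝓘(ℝ, ℝ) 𝓘(ℝ, E) c (s t))) :=
      (h.mdifferentiableAt (hcs t ht)).hasMFDerivAt.comp _ (hcd t ht).hasMFDerivAt
    obtain ⟨L, hL⟩ : ∃ L : ℝ →L[ℝ] E,
        L = (chartCoframe φ (c (s t))).comp (mfderiv 𝓘(ℝ, ℝ) 𝓘(ℝ, E) c (s t)) := ⟨_, rfl⟩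
    have h2 : HasFDerivAt (φ ∘ c) L (s t) := hasMFDerivAt_iff_hasFDerivAt.1 (hL ▸ h1)
    have hv : L 1 = chartCoframe φ (c (s t)) (velocity c (s t)) := congrArg (fun L ↦ L 1) hL
    have h3 := h2.hasDerivAt.scomp t ((hsd t ht).differentiableAt (by simp)).hasDerivAt
    have h4 : (φ ∘ c) ∘ s =ᶠ[𝓝 t] ℓ := by
      filter_upwards [hJn t ht] with t' ht' using hφc t' ht'
    have h5 := (h3.congr_of_eventuallyEq h4.symm).unique (hasDerivAt_line (φ x) u t)
    rw [← h5, smul_smul, inv_mul_cancel₀ (hs0 t ht), one_smul, hv,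
      h.chartFrame_chartCoframe (hcs t ht)]
  -- A linear form with `f u = 1` recovers `t` from `ℓ t`. This extends the speed `1 / s'` off the
  -- line, so that the velocity of `c` is the restriction of a vector field.
  obtain ⟨f, hf⟩ := SeparatingDual.exists_eq_one (R := ℝ) hu
  set k : E → ℝ := fun q ↦ (deriv s (f (q - φ x)))⁻¹ with hk
  have hkℓ : ∀ t, k (ℓ t) = (deriv s t)⁻¹ := fun t ↦ by simp [hk, hℓ, hf]
  have hx0 : c (s 0) = x := by
    rw [← φ.left_inv (hcs 0 h0J), hφc 0 h0J, hℓ0, φ.left_inv hx]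
  have hkd : DifferentiableAt ℝ k (φ (c (s 0))) := by
    have h1 : DifferentiableAt ℝ (deriv s) 0 :=
      ((hsd 0 h0J).of_le (WithTop.coe_le_coe.2 le_top)).differentiableAt_fderiv.clm_apply
        (differentiableAt_const 1)
    have h2 : DifferentiableAt ℝ (fun q ↦ f (q - φ x)) (φ x) := by fun_prop
    rw [hx0]
    refine DifferentiableAt.fun_inv (DifferentiableAt.comp (φ x) (g := deriv s) ?_ h2) ?_
    · simpa using h1
    · simpa using hs0 0 h0J
  have hk0 : k (φ (c (s 0))) ≠ 0 := by
    rw [hφc 0 h0J, hkℓ]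
    exact inv_ne_zero (hs0 0 h0J)
  rw [← hx0]
  refine h.connection_self_of_connection_smul (hcs 0 h0J) hkd hk0 ?_
  have hY : ∀ᶠ τ in 𝓝 (s 0), velocity c τ = chartField φ (fun q ↦ k q • u) (c τ) := by
    rw [← hmap 0 h0J, eventually_map]
    filter_upwards [hJn 0 h0J] with t ht
    rw [hvel t ht, chartField, hφc t ht, hkℓ]
  have hgeo := hc.2 (s 0) ⟨0, h0J, rfl⟩
  rw [D.covDerivAlong_eq (hcd 0 h0J) (h.mdifferentiableAt_chartField (hcs 0 h0J)
    (hkd.smul_const u)) hY, hY.self_of_nhds] at hgeo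
  exact hgeo

end Geodesics

/-! ### The Levi-Civita connection and the metric in a flattening chart. -/

section Metric

open Filter Topology VectorField

variable {E : Type*} [NormedAddCommGroup E] [NormedSpace ℝ E]
  {M : Type*} [TopologicalSpace M] [ChartedSpace E M] [IsManifold 𝓘(ℝ, E) ∞ M]
  {φ : OpenPartialHomeomorph M E} {D : AffineConnection E M} {x : M}
  {g : ContMDiffRiemannianMetric 𝓘(ℝ, E) ∞ E (fun x : M ↦ TangentSpace 𝓘(ℝ, E) x)}

/-- The metric in a chart. -/
noncomputable def chartMetric
    (g : ContMDiffRiemannianMetric 𝓘(ℝ, E) ∞ E (fun x : M ↦ TangentSpace 𝓘(ℝ, E) x))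
    (φ : OpenPartialHomeomorph M E) (p : E) : E →ₗ[ℝ] E →ₗ[ℝ] ℝ :=
  LinearMap.mk₂ ℝ
    (fun v w ↦ g.inner (φ.symm p) (chartFrame φ (φ.symm p) v) (chartFrame φ (φ.symm p) w))
    (fun u u' v ↦ by simp) (fun c u v ↦ by simp) (fun u v v' ↦ by simp) (fun c u v ↦ by simp)

theorem chartMetric_apply (hx : x ∈ φ.source) (v w : E) : chartMetric g φ (φ x) v w =
    g.inner x (chartFrame φ x v) (chartFrame φ x w) := by
  rw [chartMetric, LinearMap.mk₂_apply, φ.left_inv hx]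

variable [FiniteDimensional ℝ E]

/-- Fields with constant coordinates commute, so vanishing torsion is symmetry of the Christoffel
map. -/
theorem IsLeviCivita.connection_chartFrame_comm (hD : IsLeviCivita g D) (h : IsSmoothChart φ)
    (hx : x ∈ φ.source) (u v : E) :
    D (chartField φ fun _ ↦ v) x (chartFrame φ x u) =
      D (chartField φ fun _ ↦ u) x (chartFrame φ x v) := by
  have hd : ∀ u : E, MDiffAt (T% (chartField φ fun _ ↦ u)) x := fun u ↦
    h.mdifferentiableAt_chartField hx (differentiableAt_const u)
  have h1 := D.torsion_eq_zero_iff.1 hD.1 (hd u) (hd v)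
  rw [h.mlieBracket_chartField hx (differentiableAt_const u) (differentiableAt_const v)] at h1
  have h2 : chartField φ (lieBracket ℝ (fun _ : E ↦ u) fun _ ↦ v) x = 0 := by
    simp [chartField, lieBracket]
  rw [h2] at h1
  exact sub_eq_zero.1 h1

/-- The connection in a chart, as a bilinear map. -/
noncomputable def IsSmoothChart.christoffel (h : IsSmoothChart φ) (D : AffineConnection E M)
    (hx : x ∈ φ.source) : E →ₗ[ℝ] E →ₗ[ℝ] TangentSpace 𝓘(ℝ, E) x :=
  LinearMap.mk₂ ℝ (fun u v ↦ D (chartField φ fun _ ↦ v) x (chartFrame φ x u))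
    (fun u u' v ↦ by simp) (fun c u v ↦ by simp)
    (fun u v v' ↦ by
      have hd : ∀ u : E, MDiffAt (T% (chartField φ fun _ ↦ u)) x := fun u ↦
        h.mdifferentiableAt_chartField hx (differentiableAt_const u)
      have h1 : (chartField φ fun _ ↦ v + v') =
          (chartField φ fun _ ↦ v) + chartField φ fun _ ↦ v' := by
        ext y
        simp [chartField]
      rw [h1, D.isCovariantDerivativeOnUniv.add (hd v) (hd v'), add_apply])
    (fun c u v ↦ by rw [h.connection_const_smul hx, smul_apply])

/-- The polarization lemma applied to the Christoffel map at each point. The form is chosen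
pointwise, so its regularity is left open here. -/
theorem IsProjectiveEquivalence.exists_isProjForm
    (hφ : IsProjectiveEquivalence D (flatConnection E) φ) (hD : IsLeviCivita g D) :
    ∃ α : E → E →L[ℝ] ℝ, IsProjForm φ D α := by
  have h := hφ.isSmoothChart
  have key : ∀ p, ∃ a : E →L[ℝ] ℝ, ∀ x ∈ φ.source, φ x = p → ∀ u v,
      D (chartField φ fun _ ↦ v) x (chartFrame φ x u) = chartFrame φ x (a u • v + a v • u) :=
    fun p ↦ by
    by_cases hp : p ∈ φ.target
    · obtain ⟨a, ha⟩ := exists_eq_smul_add_smul_of_forall_self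
        (h.christoffel D (φ.map_target hp)) (chartFrame φ (φ.symm p)).toLinearMap
        (h.chartFrame_injective (φ.map_target hp))
        (fun u v ↦ hD.connection_chartFrame_comm h (φ.map_target hp) u v)
        (fun u ↦ hφ.connection_self (φ.map_target hp) u)
      refine ⟨a.toContinuousLinearMap, fun x hx hxp u v ↦ ?_⟩
      obtain rfl : φ.symm p = x := by rw [← hxp, φ.left_inv hx]
      exact (ha u v).trans (by simp)
    -- Off the target the value is irrelevant.
    · exact ⟨0, fun x hx hxp ↦ absurd (hxp ▸ φ.map_source hx) hp⟩
  choose α hα using key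
  exact ⟨α, fun x hx ↦ hα (φ x) x hx rfl⟩

theorem IsSmoothChart.contDiffOn_chartMetric (h : IsSmoothChart φ) (v w : E) :
    ContDiffOn ℝ ∞ (fun p ↦ chartMetric g φ p v w) φ.target := by
  intro p hp
  have hx := φ.map_target hp
  have hd : ∀ u : E, CMDiffAt ∞ (T% (chartField φ fun _ ↦ u)) (φ.symm p) := fun u ↦
    h.contMDiffAt_chartField hx contDiffAt_const
  have h1 : ContMDiffAt 𝓘(ℝ, E) (𝓘(ℝ, E).prod 𝓘(ℝ)) ∞
      (fun y ↦ TotalSpace.mk' ℝ (E := Bundle.Trivial M ℝ) y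
        (g.inner y (chartField φ (fun _ ↦ v) y) (chartField φ (fun _ ↦ w) y))) (φ.symm p) :=
    (g.contMDiff (φ.symm p)).clm_bundle_apply₂ (F₁ := E) (F₂ := E) (hd v) (hd w)
  simp only [contMDiffAt_totalSpace] at h1
  have h2 : CMDiffAt ∞ (fun y ↦ (g.inner y (chartField φ (fun _ ↦ v) y)
      (chartField φ (fun _ ↦ w) y) : ℝ)) (φ.symm p) := h1.2
  exact (h2.comp p (h.contMDiffAt_symm hp)).contDiffAt.contDiffWithinAt

theorem IsLeviCivita.fderiv_chartMetric (hD : IsLeviCivita g D) (h : IsSmoothChart φ)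
    {α : E → E →L[ℝ] ℝ} (hα : IsProjForm φ D α) {p : E} (hp : p ∈ φ.target) (u v w : E) :
    fderiv ℝ (fun q ↦ chartMetric g φ q v w) p u = 2 * α p u * chartMetric g φ p v w
      + α p v * chartMetric g φ p u w + α p w * chartMetric g φ p u v := by
  obtain ⟨x, hx, rfl⟩ : ∃ x ∈ φ.source, φ x = p := ⟨φ.symm p, φ.map_target hp, φ.right_inv hp⟩
  have hd : ∀ u : E, MDiffAt (T% (chartField φ fun _ ↦ u)) x := fun u ↦
    h.mdifferentiableAt_chartField hx (differentiableAt_const u)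
  have hF : DifferentiableAt ℝ (fun q ↦ chartMetric g φ q v w) (φ x) :=
    ((h.contDiffOn_chartMetric v w).contDiffAt (φ.open_target.mem_nhds hp)).differentiableAt
      (by simp)
  have hf := (hF.hasFDerivAt.hasMFDerivAt.comp x
    (h.mdifferentiableAt hx).hasMFDerivAt).congr_of_eventuallyEq
    (f₁ := fun y ↦ g.inner y (chartField φ (fun _ ↦ v) y) (chartField φ (fun _ ↦ w) y)) (by
      filter_upwards [φ.open_source.mem_nhds hx] with y hy
      exact (chartMetric_apply hy v w).symm)
  have h1 := hD.2 x _ _ (hd v) (hd w) (chartFrame φ x u)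
  rw [mvfderiv, hf.mfderiv] at h1
  have h2 : fderiv ℝ (fun q ↦ chartMetric g φ q v w) (φ x) u = _ :=
    (congrArg _ (h.chartCoframe_chartFrame hx u)).symm.trans h1
  rw [h2, hα x hx, hα x hx]
  simp only [chartField, chartMetric_apply hx, map_add, map_smul, add_apply, smul_apply,
    smul_eq_mul]
  rw [g.symm x (chartFrame φ x v) (chartFrame φ x u)]
  ring

/-- Smoothness of `α` is recovered from that of the metric: `∂_v G(v, v) = 4 α(v) G(v, v)`, and
`G(v, v) > 0` for `v ≠ 0`. -/
theorem IsLeviCivita.isProjMetric (hD : IsLeviCivita g D) (h : IsSmoothChart φ)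
    {α : E → E →L[ℝ] ℝ} (hα : IsProjForm φ D α) : IsProjMetric φ.target α (chartMetric g φ) where
  isOpen := φ.open_target
  contDiffOn_metric := h.contDiffOn_chartMetric
  symm p hp v w := g.symm _ _ _
  pos p hp v hv := g.pos _ _ fun h0 ↦
    hv (h.chartFrame_injective (φ.map_target hp) (h0.trans (map_zero _).symm))
  fderiv_eq p hp := hD.fderiv_chartMetric h hα hp
  contDiffOn_form := by
    rw [contDiffOn_clm_apply]
    intro v
    by_cases hv : v = 0
    · simpa [hv] using contDiffOn_const
    have h1 : ContDiffOn ℝ ∞ (fun p ↦ fderiv ℝ (fun q ↦ chartMetric g φ q v v) p v) φ.target :=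
      ((h.contDiffOn_chartMetric v v).fderiv_of_isOpen φ.open_target (by simp)).clm_apply
        contDiffOn_const
    have hpos : ∀ p ∈ φ.target, 0 < chartMetric g φ p v v := fun p hp ↦ g.pos _ _ fun h0 ↦
      hv (h.chartFrame_injective (φ.map_target hp) (h0.trans (map_zero _).symm))
    refine (h1.div (contDiffOn_const (c := (4 : ℝ)).mul (h.contDiffOn_chartMetric v v))
      fun p hp ↦ (mul_pos four_pos (hpos p hp)).ne').congr fun p hp ↦ ?_
    have := (hpos p hp).ne'
    rw [Pi.div_apply, hD.fderiv_chartMetric h hα hp, eq_div_iff (by positivity)]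
    ring

end Metric

/-! ### From pointwise to global constancy of the curvature. -/

section Beltrami

open Filter Topology

variable {E : Type*} [NormedAddCommGroup E] [NormedSpace ℝ E] [FiniteDimensional ℝ E]
  {M : Type*} [TopologicalSpace M] [ChartedSpace E M] [IsManifold 𝓘(ℝ, E) ∞ M]
  {φ : OpenPartialHomeomorph M E} {D : AffineConnection E M} {x : M}
  {g : ContMDiffRiemannianMetric 𝓘(ℝ, E) ∞ E (fun x : M ↦ TangentSpace 𝓘(ℝ, E) x)}

/-- The curvature of `D` at the point `x` is that of constant sectional curvature `K`. -/
def HasCurvatureAt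
    (g : ContMDiffRiemannianMetric 𝓘(ℝ, E) ∞ E (fun x : M ↦ TangentSpace 𝓘(ℝ, E) x))
    (D : AffineConnection E M) (x : M) (K : ℝ) : Prop :=
  ∀ X Y Z : ∀ x : M, TangentSpace 𝓘(ℝ, E) x,
    CMDiffAt ∞ (T% X) x → CMDiffAt ∞ (T% Y) x → CMDiffAt ∞ (T% Z) x →
    curvature D X Y Z x = K • (g.inner x (Y x) (Z x) • X x - g.inner x (X x) (Z x) • Y x)

/-- A Schouten tensor proportional to the metric is symmetric, so the `Z` term of the curvature
drops out. -/
theorem IsProjForm.hasCurvatureAt {α : E → E →L[ℝ] ℝ} (hα : IsProjForm φ D α)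
    (h : IsSmoothChart φ) (hx : x ∈ φ.source) (hαd : DifferentiableAt ℝ α (φ x)) {k : ℝ}
    (hk : ∀ v w, schouten α (φ x) v w = -(k * chartMetric g φ (φ x) v w)) :
    HasCurvatureAt g D x k := by
  intro X Y Z hX hY hZ
  have hrep : ∀ W : ∀ x : M, TangentSpace 𝓘(ℝ, E) x,
      chartFrame φ x (chartRep φ W (φ x)) = W x := h.chartField_chartRep hx
  rw [hα.curvature_eq h hx hαd hX hY hZ]
  simp only [chartField, hk, chartMetric_apply hx, map_add, map_sub, map_smul, hrep]
  rw [g.symm x (Y x) (X x)]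
  module

/-- Orthogonal nonzero `v`, `w` detect the factor: `R(v, w)w = k g(w, w) v`. This makes the locally
constant factors from different charts agree. -/
theorem HasCurvatureAt.unique (h : IsSmoothChart φ) (hx : x ∈ φ.source)
    (hdim : 2 ≤ Module.finrank ℝ E) {k k' : ℝ} (hk : HasCurvatureAt g D x k)
    (hk' : HasCurvatureAt g D x k') : k = k' := by
  have : Nontrivial E := Module.nontrivial_of_finrank_pos (R := ℝ) (by omega)
  obtain ⟨v, hv⟩ := exists_ne (0 : E)
  have hne : ∀ u : E, u ≠ 0 → chartFrame φ x u ≠ 0 := fun u hu h0 ↦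
    hu (h.chartFrame_injective hx (h0.trans (map_zero _).symm))
  obtain ⟨w, hw, hvw⟩ := exists_ne_zero_orthogonal (g := chartMetric g φ (φ x)) hdim v
  rw [chartMetric_apply hx] at hvw
  have hc : ∀ u : E, CMDiffAt ∞ (T% (chartField φ fun _ ↦ u)) x := fun u ↦
    h.contMDiffAt_chartField hx contDiffAt_const
  have heq := (hk _ _ _ (hc v) (hc w) (hc w)).symm.trans (hk' _ _ _ (hc v) (hc w) (hc w))
  simp only [chartField, hvw, zero_smul, sub_zero, smul_smul] at heq
  exact mul_right_cancel₀ (g.pos x _ (hne w hw)).ne' (smul_left_injective ℝ (hne v hv) heq)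

theorem IsProjectivelyFlat.exists_hasCurvatureAt (hflat : IsProjectivelyFlat D)
    (hD : IsLeviCivita g D) (x : M) : ∃ k, HasCurvatureAt g D x k := by
  obtain ⟨φ, hx, hφ⟩ := hflat x
  obtain ⟨α, hα⟩ := hφ.exists_isProjForm hD
  have hm := hD.isProjMetric hφ.isSmoothChart hα
  obtain ⟨k, hk⟩ := hm.exists_schouten_eq (φ.map_source hx)
  exact ⟨k, hα.hasCurvatureAt hφ.isSmoothChart hx
    (hm.differentiableAt_form (φ.map_source hx)) hk⟩

theorem IsProjectivelyFlat.eventually_hasCurvatureAt (hflat : IsProjectivelyFlat D)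
    (hD : IsLeviCivita g D) (hdim : 2 ≤ Module.finrank ℝ E) (x : M) :
    ∃ k, ∀ᶠ y in 𝓝 x, HasCurvatureAt g D y k := by
  obtain ⟨φ, hx, hφ⟩ := hflat x
  obtain ⟨α, hα⟩ := hφ.exists_isProjForm hD
  have hm := hD.isProjMetric hφ.isSmoothChart hα
  obtain ⟨k, hk⟩ := hm.eventually_schouten_eq hdim (φ.map_source hx)
  refine ⟨k, ?_⟩
  filter_upwards [(φ.continuousAt hx).eventually hk, φ.open_source.mem_nhds hx] with y hy hys
  exact hα.hasCurvatureAt hφ.isSmoothChart hys (hm.differentiableAt_form (φ.map_source hys)) hy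

/-- Beltrami's theorem, over an arbitrary finite-dimensional model space. -/
theorem IsProjectivelyFlat.exists_hasConstantCurvature [PreconnectedSpace M]
    (hflat : IsProjectivelyFlat D) (hD : IsLeviCivita g D) :
    ∃ K : ℝ, HasConstantCurvature g D K := by
  choose κ hκ using hflat.exists_hasCurvatureAt hD
  by_cases hdim : 2 ≤ Module.finrank ℝ E
  · have hloc : IsLocallyConstant κ := by
      rw [IsLocallyConstant.iff_eventually_eq]
      intro x
      obtain ⟨k, hk⟩ := hflat.eventually_hasCurvatureAt hD hdim x
      have huniq : ∀ y, HasCurvatureAt g D y k → κ y = k := fun y hy ↦ by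
        obtain ⟨φ, hys, hφ⟩ := hflat y
        exact (hκ y).unique hφ.isSmoothChart hys hdim hy
      filter_upwards [hk] with y hy
      rw [huniq y hy, huniq x hk.self_of_nhds]
    rcases isEmpty_or_nonempty M with hM | ⟨⟨x₀⟩⟩
    · exact ⟨0, fun x ↦ hM.elim x⟩
    · refine ⟨κ x₀, fun x ↦ ?_⟩
      rw [hloc.apply_eq_of_preconnectedSpace x₀ x]
      exact hκ x
  -- In dimension at most one `κ` is not unique and may vary, but it multiplies a tensor that
  -- vanishes, so `K = 0` serves.
  · refine ⟨0, fun x X Y Z hX hY hZ ↦ ?_⟩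
    have : FiniteDimensional ℝ (TangentSpace 𝓘(ℝ, E) x) := inferInstanceAs (FiniteDimensional ℝ E)
    have hdim' : Module.finrank ℝ (TangentSpace 𝓘(ℝ, E) x) ≤ 1 := by
      change Module.finrank ℝ E ≤ 1
      omega
    have h0 := smul_sub_smul_eq_zero_of_finrank_le_one hdim'
      (g := LinearMap.mk₂ ℝ (fun v w ↦ g.inner x v w) (by simp) (by simp) (by simp) (by simp))
      (X x) (Y x) (Z x)
    simp only [LinearMap.mk₂_apply] at h0
    rw [hκ x X Y Z hX hY hZ, zero_smul, h0, smul_zero]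

end Beltrami

/-- Beltrami's theorem: a projectively flat Riemannian metric has constant curvature. -/
theorem mainTheorem7 (n : ℕ)
    (M : Type*) [TopologicalSpace M] [PreconnectedSpace M]
    [ChartedSpace (EuclideanSpace ℝ (Fin n)) M] [IsManifold (𝓡 n) ∞ M]
    (g : ContMDiffRiemannianMetric (𝓡 n) ∞ (EuclideanSpace ℝ (Fin n))
      (fun x : M ↦ TangentSpace (𝓡 n) x))
    (D : AffineConnection (EuclideanSpace ℝ (Fin n)) M)
    (hD : IsLeviCivita g D) (hflat : IsProjectivelyFlat D) :
    ∃ K : ℝ, HasConstantCurvature g D K :=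
  hflat.exists_hasConstantCurvature hD
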